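/- Let $2\le m\le K$ and $T\ge 1$ be integers, and let $P\in[0,1]^{K\times K}$ be a preference matrix ($P(i,j)+P(j,i)=1$, $P(i,i)=\tfrac12$) with a Condorcet winner $a^\star$ with positive gaps: $P(a^\star,i)\ge\tfrac12$ for all $i$, and $\Delta_i:=P(a^\star,i)-\tfrac12>0$ for all $i\neq a^\star$. In each round $t=1,\dots,T$ a learner plays $m$ arms with repetition, $\mathcal A_t:[m]\to[K]$, and observes the winning position $I_t\in[m]$, which, given $\mathcal A_t$ and the past, equals $i$ with probability $\sum_{j\ne i}\frac{2P(\mathcal A_t(i),\mathcal A_t(j))}{m(m-1)}$. Its pseudo-regret is $R_T^{\mathrm C}:=\sum_{t=1}^T\frac1m\sum_{j=1}^m\Delta_{\mathcal A_t(j)}$ (with $\Delta_{a^\star}=0$). The learner is MetaDueling with base algorithm Versatile-DB, i.e. the following. In round $t$ two players $\pm1$ have the distributions $$p_{\pm1,t}=\arg\min_{p\in\Delta_K}\ \langle p,\hat L_{\pm1,t-1}\rangle-\frac{4}{\eta_t}\sum_{k=1}^K\Bigl(\sqrt{p(k)}-\frac{p(k)}2\Bigr),\qquad \eta_t=\frac{2}{\sqrt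 t},\qquad \hat L_{\pm1,0}=0,$$ where $\Delta_K$ is the probability simplex. Independently, $x_t\sim p_{+1,t}$ and $y_t\sim p_{-1,t}$ are drawn, and $\mathcal A_t$ consists of $n_x$ copies of $x_t$ followed by $m-n_x$ copies of $y_t$, where $n_x=m/2$ if $m$ is even, and $n_x$ is $\lceil m/2\rceil$ or $\lfloor m/2\rfloor$ with probability $\tfrac12$ each (independently of everything else so far) if $m$ is odd. Set $o_t=1$ if $I_t\le n_x$ (a copy of $x_t$ wins) and $o_t=0$ otherwise, and update $$\hat L_{+1,t}(k)=\hat L_{+1,t-1}(k)+\frac{\mathbf 1[k=x_t](1-o_t)}{p_{+1,t}(k)},\qquad \hat L_{-1,t}(k)=\hat L_{-1,t-1}(k)+\frac{\mathbf 1[k=y_t]\,o_t}{p_{-1,t}(k)}.$$ Let $\beta_m=\frac{m}{2(m-1)}$ for even $m$, $\beta_m=\frac{m+1}{2m}$ for odd $m$, $\alpha_m=\frac{1-\beta_m}2$, $\widehat P=\alpha_m+\beta_mP$ (entrywise), $\widehat\Delta(i)=\widehat P(a^\star,i)-\tfrac12$, and $\widehat R_T^{\mathrm{DB}}=\sum_{t=1}^T\frac12\bigl(\widehat\Delta(x_t)+\widehat\Delta(y_t)\bigr)$.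 Then the self-bounding condition holds with equality: $$\mathbb E[\widehat R_T^{\mathrm{DB}}]=\frac12\,\mathbb E\Bigl[\sum_{t=1}^T\sum_{i\ne a^\star}\bigl(p_{+1,t}(i)+p_{-1,t}(i)\bigr)\widehat\Delta(i)\Bigr],$$ and $$\mathbb E[R_T^{\mathrm C}]\le\sum_{i\ne a^\star}\frac{64\log T+192}{\Delta_i}+8\log T+24+16\sqrt K .$$ Moreover there is a universal constant $C>0$ (independent of $K$, $m$, $T$, $P$) such that for $T\ge2$ the right-hand side is at most $C\sum_{i\ne a^\star}\frac{\log T}{\Delta_i}$. -/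

import Mathlib

noncomputable section

namespace MultiDueling

/-- A preference matrix on `K` arms: entries in `[0, 1]`, reciprocal, ties on the diagonal. -/
structure PrefMatrix (K : ℕ) where
  val : Fin K → Fin K → ℝ
  nonneg : ∀ i j, 0 ≤ val i j
  le_one : ∀ i j, val i j ≤ 1
  reciprocal : ∀ i j, val i j + val j i = 1
  self : ∀ i, val i i = 1 / 2

/-- `a` is a Condorcet winner of `P`. -/
def IsCondorcetWinner {K : ℕ} (P : PrefMatrix K) (a : Fin K) : Prop :=
  ∀ i, 1 / 2 ≤ P.val a i

/-- The sub-optimality gap of arm `i` with respect to `a`. -/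
def gap {K : ℕ} (P : PrefMatrix K) (a i : Fin K) : ℝ := P.val a i - 1 / 2

/-! ### Choice model -/

/-- Pairwise-subset choice model: the probability that position `i` of `A` wins. -/
def winProb {K m : ℕ} (P : PrefMatrix K) (A : Fin m → Fin K) (i : Fin m) : ℝ :=
  ∑ j ∈ Finset.univ.erase i, 2 * P.val (A i) (A j) / ((m : ℝ) * ((m : ℝ) - 1))

lemma winProb_nonneg {K m : ℕ} (hm : 2 ≤ m) (P : PrefMatrix K) (A : Fin m → Fin K)
    (i : Fin m) : 0 ≤ winProb P A i := by
  have h : (2 : ℝ) ≤ m := by exact_mod_cast hm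
  refine Finset.sum_nonneg fun j _ => div_nonneg ?_ (mul_nonneg (by linarith) (by linarith))
  exact mul_nonneg (by norm_num) (P.nonneg _ _)

lemma sum_winProb {K m : ℕ} (hm : 2 ≤ m) (P : PrefMatrix K) (A : Fin m → Fin K) :
    ∑ i, winProb P A i = 1 := by
  have h : (2 : ℝ) ≤ m := by exact_mod_cast hm
  have h1 : ∀ i, winProb P A i =
      (2 / ((m : ℝ) * ((m : ℝ) - 1))) * ((∑ j, P.val (A i) (A j)) - 1 / 2) := by
    intro i
    have h2 := Finset.add_sum_erase Finset.univ (fun j => P.val (A i) (A j)) (Finset.mem_univ i)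
    have h3 := P.self (A i)
    simp only [h3] at h2
    rw [← h2, winProb, add_sub_cancel_left, Finset.mul_sum]
    exact Finset.sum_congr rfl fun j _ => by ring
  have h4 : ∑ i, ∑ j, P.val (A i) (A j) = (m : ℝ) * m / 2 := by
    have h5 : ∑ i, ∑ j, P.val (A i) (A j) + ∑ i, ∑ j, P.val (A i) (A j) = (m : ℝ) * m := by
      nth_rewrite 2 [Finset.sum_comm]
      simp [← Finset.sum_add_distrib, P.reciprocal]
    linarith
  simp only [h1]
  rw [← Finset.mul_sum, Finset.sum_sub_distrib, h4]
  have h6 : (m : ℝ) ≠ 0 := by linarith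
  have h7 : (m : ℝ) - 1 ≠ 0 := by linarith
  simp only [Finset.sum_const, Finset.card_univ, Fintype.card_fin, nsmul_eq_mul]
  field_simp

/-- The law of the winning position. -/
def winnerLaw {K m : ℕ} (hm : 2 ≤ m) (P : PrefMatrix K) (A : Fin m → Fin K) : PMF (Fin m) :=
  PMF.ofFintype (fun i => ENNReal.ofReal (winProb P A i)) (by
    rw [← ENNReal.ofReal_sum_of_nonneg (fun i _ => winProb_nonneg hm P A i), sum_winProb hm,
      ENNReal.ofReal_one])

/-! ### Dueling bandit algorithms -/

/-- The record of one duel: the two arms, and whether the first one won (`o = true`). -/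
structure Duel (K : ℕ) where
  x : Fin K
  y : Fin K
  o : Bool

/-- A dueling bandit algorithm with two independent players: the distributions of the first and
of the second arm of the next round, as functions of the past duels (most recent first). -/
structure DuelingAlgorithm (K : ℕ) where
  q₁ : List (Duel K) → PMF (Fin K)
  q₂ : List (Duel K) → PMF (Fin K)

/-- Objective of follow-the-regularized-leader in round `t = 1, 2, …` for cumulative loss
estimates `L`, with `1/2`-Tsallis regularizer and learning rate `2 / √t`. -/
def tsallisObjective {K : ℕ} (t : ℕ) (L p : Fin K → ℝ) : ℝ :=
  ∑ k, p k * L k - 4 / (2 / √(t : ℝ)) * ∑ k, (√(p k) - p k / 2)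

lemma exists_tsallis_minimizer {K : ℕ} [NeZero K] (t : ℕ) (L : Fin K → ℝ) :
    ∃ p ∈ stdSimplex ℝ (Fin K), IsMinOn (tsallisObjective t L) (stdSimplex ℝ (Fin K)) p := by
  refine (isCompact_stdSimplex ℝ (Fin K)).exists_isMinOn ⟨_, single_mem_stdSimplex ℝ (0 : Fin K)⟩ ?_
  unfold tsallisObjective
  fun_prop

/-- The minimizer over the simplex of the objective of round `t`
(it is unique, the objective being strictly convex for `t ≥ 1`). -/
def tsallisWeights {K : ℕ} [NeZero K] (t : ℕ) (L : Fin K → ℝ) : Fin K → ℝ :=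
  (exists_tsallis_minimizer t L).choose

lemma tsallisWeights_mem {K : ℕ} [NeZero K] (t : ℕ) (L : Fin K → ℝ) :
    tsallisWeights t L ∈ stdSimplex ℝ (Fin K) :=
  (exists_tsallis_minimizer t L).choose_spec.1

/-- The distribution with the weights `tsallisWeights t L`. -/
def tsallisLaw {K : ℕ} [NeZero K] (t : ℕ) (L : Fin K → ℝ) : PMF (Fin K) :=
  PMF.ofFintype (fun k => ENNReal.ofReal (tsallisWeights t L k)) (by
    rw [← ENNReal.ofReal_sum_of_nonneg (fun k _ => (tsallisWeights_mem t L).1 k),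
      (tsallisWeights_mem t L).2, ENNReal.ofReal_one])

/-- Cumulative importance-weighted loss estimates of the two players of Versatile-DB. A player
suffers loss `1` when its arm loses the duel, and `0` when it wins. -/
def versatileLosses {K : ℕ} [NeZero K] : List (Duel K) → (Fin K → ℝ) × (Fin K → ℝ)
  | [] => (fun _ => 0, fun _ => 0)
  | d :: H =>
    (fun k => (versatileLosses H).1 k +
      if k = d.x then
        (if d.o then 0 else 1) / tsallisWeights (H.length + 1) (versatileLosses H).1 k
      else 0,
     fun k => (versatileLosses H).2 k +
      if k = d.y then
        (if d.o then 1 else 0) / tsallisWeights (H.length + 1) (versatileLosses H).2 k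
      else 0)

/-- Versatile-DB: each player runs Tsallis-FTRL on its own importance-weighted losses. -/
def versatileDB (K : ℕ) [NeZero K] : DuelingAlgorithm K where
  q₁ H := tsallisLaw (H.length + 1) (versatileLosses H).1
  q₂ H := tsallisLaw (H.length + 1) (versatileLosses H).2

/-! ### MetaDueling -/

/-- Number of copies of the first arm, `b` being the fair coin used for odd `m`. -/
def countFirst (m : ℕ) (b : Bool) : ℕ :=
  if Even m then m / 2 else if b then (m + 1) / 2 else m / 2

/-- The played multiset: `countFirst m b` copies of `x`, followed by copies of `y`. -/
def playedArms {K : ℕ} (m : ℕ) (x y : Fin K) (b : Bool) : Fin m → Fin K :=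
  fun i => if i.val < countFirst m b then x else y

/-- The random data of one round: the arms `x` and `y` proposed by the base algorithm, the coin
and the winning position. -/
abbrev Round (K m : ℕ) : Type := Fin K × Fin K × Bool × Fin m

namespace Round

variable {K m : ℕ}

def x (r : Round K m) : Fin K := r.1

def y (r : Round K m) : Fin K := r.2.1

def coin (r : Round K m) : Bool := r.2.2.1

def winner (r : Round K m) : Fin m := r.2.2.2

/-- The multiset played in the round. -/
def arms (r : Round K m) : Fin m → Fin K := playedArms m r.x r.y r.coin

/-- What is fed to the base algorithm: the first arm won if and only if the winning position is
one of those occupied by the copies of the first arm. -/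
def duel (r : Round K m) : Duel K :=
  ⟨r.x, r.y, decide (r.winner.val < countFirst m r.coin)⟩

end Round

/-- The duels seen by the base algorithm in `t` rounds, most recent first. -/
def baseHistory {K m : ℕ} : (t : ℕ) → (Fin t → Round K m) → List (Duel K)
  | 0, _ => []
  | t + 1, h => Round.duel (h (Fin.last t)) :: baseHistory t (fun s => h s.castSucc)

/-- The duels seen by the base algorithm before round `t` of the `T` rounds `h`. -/
def pastDuels {K m T : ℕ} (h : Fin T → Round K m) (t : Fin T) : List (Duel K) :=
  baseHistory t.val (fun s : Fin t.val => h (s.castLE t.isLt.le))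

/-- The law of one round of MetaDueling with base algorithm `D`, past duels `H` and current
preference matrix `P`. -/
def roundLaw {K m : ℕ} (hm : 2 ≤ m) (D : DuelingAlgorithm K) (P : PrefMatrix K)
    (H : List (Duel K)) : PMF (Round K m) :=
  (D.q₁ H).bind fun x =>
    (D.q₂ H).bind fun y =>
      (PMF.uniformOfFintype Bool).bind fun b =>
        (winnerLaw hm P (playedArms m x y b)).map fun w => (x, y, b, w)

/-- The law of `T` rounds of MetaDueling with base algorithm `D` against the oblivious sequence
of preference matrices `Ps` (rounds are indexed from `0`). -/
def metaDuelingLaw {K m : ℕ} (hm : 2 ≤ m) (D : DuelingAlgorithm K) (Ps : ℕ → PrefMatrix K) :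
    (T : ℕ) → PMF (Fin T → Round K m)
  | 0 => PMF.pure Fin.elim0
  | T + 1 =>
    (metaDuelingLaw hm D Ps T).bind fun h =>
      (roundLaw hm D (Ps T) (baseHistory T h)).map fun r =>
        Fin.snoc (α := fun _ => Round K m) h r

/-- Expectation of a real random variable on a finite probability space. -/
def expect {Ω : Type} [Fintype Ω] (μ : PMF Ω) (X : Ω → ℝ) : ℝ := ∑ ω, (μ ω).toReal * X ω

/-! ### Regrets -/

/-- Cumulative Condorcet pseudo-regret of the played multisets. -/
def condorcetRegret {K m T : ℕ} (Ps : ℕ → PrefMatrix K) (a : Fin K)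
    (h : Fin T → Round K m) : ℝ :=
  ∑ t : Fin T, 1 / (m : ℝ) * ∑ j : Fin m, gap (Ps t) a (Round.arms (h t) j)

/-- The rescaling constant `β_m`. -/
def rescaleBeta (m : ℕ) : ℝ :=
  if Even m then (m : ℝ) / (2 * ((m : ℝ) - 1)) else ((m : ℝ) + 1) / (2 * (m : ℝ))

/-- The rescaling constant `α_m`. -/
def rescaleAlpha (m : ℕ) : ℝ := (1 - rescaleBeta m) / 2

/-- Entries of the rescaled preference matrix. -/
def rescaledPref {K : ℕ} (m : ℕ) (P : PrefMatrix K) (i j : Fin K) : ℝ :=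
  rescaleAlpha m + rescaleBeta m * P.val i j

/-- The gap of arm `i` in the rescaled preference matrix. -/
def rescaledGap {K : ℕ} (m : ℕ) (P : PrefMatrix K) (a i : Fin K) : ℝ :=
  rescaledPref m P a i - 1 / 2

/-- Pseudo-regret of the base algorithm under the rescaled preference matrices. -/
def baseRegret {K m T : ℕ} (Ps : ℕ → PrefMatrix K) (a : Fin K) (h : Fin T → Round K m) : ℝ :=
  ∑ t : Fin T,
    1 / 2 * (rescaledGap m (Ps t) a (Round.x (h t)) + rescaledGap m (Ps t) a (Round.y (h t)))

/-- Rescaled gaps (of the fixed matrix `P`) of the sub-optimal arms, weighted by the arm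
distributions of the two players of `D`, summed over the rounds. -/
def suboptimalMass {K m T : ℕ} (D : DuelingAlgorithm K) (P : PrefMatrix K) (a : Fin K)
    (h : Fin T → Round K m) : ℝ :=
  ∑ t : Fin T, ∑ i ∈ Finset.univ.erase a,
    ((D.q₁ (pastDuels h t) i).toReal + (D.q₂ (pastDuels h t) i).toReal) * rescaledGap m P a i

end MultiDueling

end

open MultiDueling

/-! Averaged over the coin and the winner, the duel fed to the base algorithm is a Bernoulli trial
with the rescaled preference of `x` over `y` (`expect_duel`), and the multiset played has mean gap
equal to the average gap of `x` and `y`. Rescaled gaps are `β_m` times the original ones, so the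
base regret is `β_m ≥ 1/2` times the Condorcet regret in expectation. The self-bounding equality is
the tower property plus the vanishing gap of `a`.

The duel is a zero-sum game: the two players' losses sum to `1`, while the comparator `a` loses
`1/2` minus the mean gap of the opponent's arm. Hence the two regrets against `a` add up exactly to
the gaps weighted by `p + q` (`sum_regret_eq`), and each player can be analysed as a separate
adversarial bandit.

For one player the potential is the optimal FTRL value, normalized by the loss of `a`. Its one-round
change controls the regret up to `playerError`, of order `∑_{i ≠ a} √p_i / √t` (`player_regret_le`).
Leaving `a` out of that sum is essential; it comes from centring the loss estimate when `a` itself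
is drawn (`potential_drop_le_of_four_le`). By AM-GM this error is at most half of the weighted gaps
plus a multiple of `∑ 1 / (t Δ̂_i)` (`sqrt_le_self_bound`). Absorbing that half and telescoping the
potential, which starts at `0` and stays nonpositive, leaves a harmonic sum and thus `log T`. -/

noncomputable section

namespace MultiDueling

/-! ### The Tsallis potential -/

/-- Minimal value over the simplex of the linear loss plus the `1/2`-Tsallis regularizer. -/
def tsallisPotential {K : ℕ} [NeZero K] (t : ℕ) (L : Fin K → ℝ) : ℝ :=
  ∑ k, tsallisWeights t L k * L k - 2 * √(t : ℝ) * ∑ k, √(tsallisWeights t L k)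

/-- The linear part of the regularizer is constant on the simplex, so `tsallisPotential` may drop
it. -/
lemma tsallisObjective_eq {K : ℕ} (t : ℕ) (L : Fin K → ℝ) {p : Fin K → ℝ}
    (hp : p ∈ stdSimplex ℝ (Fin K)) :
    tsallisObjective t L p = ∑ k, p k * L k - 2 * √(t : ℝ) * ∑ k, √(p k) + √(t : ℝ) := by
  have h : (4 : ℝ) / (2 / √(t : ℝ)) = 2 * √(t : ℝ) := by
    rw [div_div_eq_mul_div]; ring
  rw [tsallisObjective, h, Finset.sum_sub_distrib, ← Finset.sum_div, hp.2]
  ring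

lemma tsallisPotential_le {K : ℕ} [NeZero K] (t : ℕ) (L : Fin K → ℝ) {p : Fin K → ℝ}
    (hp : p ∈ stdSimplex ℝ (Fin K)) :
    tsallisPotential t L ≤ ∑ k, p k * L k - 2 * √(t : ℝ) * ∑ k, √(p k) := by
  have h := (exists_tsallis_minimizer t L).choose_spec.2 hp
  have h1 : tsallisObjective t L (tsallisWeights t L) ≤ tsallisObjective t L p := h
  rw [tsallisObjective_eq t L (tsallisWeights_mem t L), tsallisObjective_eq t L hp] at h1
  rw [tsallisPotential]
  linarith

/-- Completing the square in `√q` serves twice: discarding the square gives weak duality, and its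
vanishing identifies the minimizer. -/
lemma mul_sub_sqrt_eq {s q w : ℝ} (hq : 0 ≤ q) (hw : 0 < w) :
    q * w - 2 * s * √q = w * (√q - s / w) ^ 2 - s ^ 2 / w := by
  have h : w * (√q - s / w) ^ 2 = w * √q ^ 2 - 2 * s * √q + s ^ 2 / w := by
    field_simp; ring
  rw [h, Real.sq_sqrt hq]; ring

/-- Weak duality for the Tsallis potential. -/
lemma dual_le_tsallisPotential {K : ℕ} [NeZero K] (t : ℕ) (L : Fin K → ℝ) (ν : ℝ)
    (hν : ∀ i, 0 < L i + ν) :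
    -ν - ∑ i, (t : ℝ) / (L i + ν) ≤ tsallisPotential t L := by
  have hp := tsallisWeights_mem t L
  have h : ∀ i, -((t : ℝ) / (L i + ν)) ≤
      tsallisWeights t L i * (L i + ν) - 2 * √(t : ℝ) * √(tsallisWeights t L i) := by
    intro i
    rw [mul_sub_sqrt_eq (hp.1 i) (hν i), Real.sq_sqrt (Nat.cast_nonneg t)]
    have := mul_nonneg (hν i).le (sq_nonneg (√(tsallisWeights t L i) - √(t : ℝ) / (L i + ν)))
    linarith
  have h2 := Finset.sum_le_sum fun i (_ : i ∈ Finset.univ) => h i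
  simp only [mul_add, Finset.sum_sub_distrib, Finset.sum_add_distrib, ← Finset.sum_mul, hp.2,
    ← Finset.mul_sum, Finset.sum_neg_distrib] at h2
  rw [tsallisPotential]
  linarith

/-- Existence of a multiplier for the simplex constraint. -/
lemma exists_multiplier {K : ℕ} [NeZero K] {t : ℕ} (ht : 0 < t) (L : Fin K → ℝ) :
    ∃ ν : ℝ, (∀ i, 0 < L i + ν) ∧ ∑ i, (t : ℝ) / (L i + ν) ^ 2 = 1 := by
  -- Intermediate value theorem in `ν`: at `√t - min L` the term of the minimal arm alone equals
  -- `1`, and at `√t K - min L` each of the `K` terms is at most `1 / K² ≤ 1 / K`.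
  obtain ⟨j, hj⟩ := Finite.exists_min L
  have ht' : (0 : ℝ) < t := by exact_mod_cast ht
  have hs : 0 < √(t : ℝ) := Real.sqrt_pos.2 ht'
  have hK : (1 : ℝ) ≤ K := by exact_mod_cast NeZero.one_le
  have hs2 : √(t : ℝ) ^ 2 = t := Real.sq_sqrt ht'.le
  have hle : √(t : ℝ) - L j ≤ √(t : ℝ) * K - L j := by nlinarith
  have hpos : ∀ ν, √(t : ℝ) - L j ≤ ν → ∀ i, √(t : ℝ) ≤ L i + ν := by
    intro ν hν i; have := hj i; linarith
  have hc : ContinuousOn (fun ν : ℝ => ∑ i, (t : ℝ) / (L i + ν) ^ 2)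
      (Set.Icc (√(t : ℝ) - L j) (√(t : ℝ) * K - L j)) := by
    refine continuousOn_finsetSum _ fun i _ => ContinuousOn.div (by fun_prop) (by fun_prop) ?_
    intro ν hν
    exact pow_ne_zero 2 (hs.trans_le (hpos ν hν.1 i)).ne'
  have hl : 1 ≤ ∑ i, (t : ℝ) / (L i + (√(t : ℝ) - L j)) ^ 2 := by
    have h1 : (t : ℝ) / (L j + (√(t : ℝ) - L j)) ^ 2 = 1 := by
      rw [add_sub_cancel, hs2, div_self ht'.ne']
    rw [← h1]
    exact Finset.single_le_sum (f := fun i => (t : ℝ) / (L i + (√(t : ℝ) - L j)) ^ 2)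
      (fun i _ => by positivity) (Finset.mem_univ j)
  have hr : ∑ i, (t : ℝ) / (L i + (√(t : ℝ) * K - L j)) ^ 2 ≤ 1 := by
    have h1 : ∀ i ∈ Finset.univ, (t : ℝ) / (L i + (√(t : ℝ) * K - L j)) ^ 2 ≤ 1 / (K : ℝ) := by
      intro i _
      have h2 : √(t : ℝ) * K ≤ L i + (√(t : ℝ) * K - L j) := by have := hj i; linarith
      have h3 : (√(t : ℝ) * K) ^ 2 ≤ (L i + (√(t : ℝ) * K - L j)) ^ 2 := by gcongr
      rw [div_le_div_iff₀ (lt_of_lt_of_le (by positivity) h3) (by linarith), one_mul]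
      refine le_trans ?_ h3
      rw [mul_pow, hs2]
      nlinarith
    refine (Finset.sum_le_sum h1).trans ?_
    simp only [Finset.sum_const, Finset.card_univ, Fintype.card_fin, nsmul_eq_mul]
    rw [mul_one_div, div_self (by linarith)]
  obtain ⟨ν, hν, h⟩ := intermediate_value_Icc' hle hc ⟨hr, hl⟩
  exact ⟨ν, fun i => hs.trans_le (hpos ν hν.1 i), h⟩

/-- First-order conditions for the minimizer. -/
lemma exists_sqrt_tsallisWeights_eq {K : ℕ} [NeZero K] {t : ℕ} (ht : 0 < t) (L : Fin K → ℝ) :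
    ∃ ν : ℝ, (∀ i, 0 < L i + ν) ∧ ∀ i, √(tsallisWeights t L i) = √(t : ℝ) / (L i + ν) := by
  obtain ⟨ν, hν, hsum⟩ := exists_multiplier ht L
  refine ⟨ν, hν, ?_⟩
  have ht' : (0 : ℝ) ≤ t := Nat.cast_nonneg t
  have hp := tsallisWeights_mem t L
  have hsq : ∀ i, √((t : ℝ) / (L i + ν) ^ 2) = √(t : ℝ) / (L i + ν) := fun i => by
    rw [Real.sqrt_div ht', Real.sqrt_sq (hν i).le]
  have h1 : tsallisPotential t L ≤ -ν - ∑ i, (t : ℝ) / (L i + ν) := by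
    refine (tsallisPotential_le t L (p := fun i => (t : ℝ) / (L i + ν) ^ 2)
      ⟨fun i => by positivity, hsum⟩).trans_eq ?_
    have h2 : -ν = ∑ i, -ν * ((t : ℝ) / (L i + ν) ^ 2) := by rw [← Finset.mul_sum, hsum, mul_one]
    conv_rhs => rw [h2]
    rw [Finset.mul_sum, ← Finset.sum_sub_distrib, ← Finset.sum_sub_distrib]
    refine Finset.sum_congr rfl fun i _ => ?_
    rw [hsq]
    have h3 := Real.sq_sqrt ht'
    have h4 := (hν i).ne'
    field_simp
    rw [h3]; ring
  -- This sum of squares is the gap between the potential and the dual value at `ν`, which the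
  -- primal candidate `t / (L i + ν) ^ 2` has just closed. No differentiation is needed.
  have h2 : ∑ i, (L i + ν) * (√(tsallisWeights t L i) - √(t : ℝ) / (L i + ν)) ^ 2 ≤ 0 := by
    have h3 : ∀ i, (L i + ν) * (√(tsallisWeights t L i) - √(t : ℝ) / (L i + ν)) ^ 2 =
        tsallisWeights t L i * (L i + ν) - 2 * √(t : ℝ) * √(tsallisWeights t L i)
          + (t : ℝ) / (L i + ν) := fun i => by
      rw [mul_sub_sqrt_eq (hp.1 i) (hν i), Real.sq_sqrt ht']; ring
    simp only [h3, mul_add, Finset.sum_sub_distrib, Finset.sum_add_distrib, ← Finset.sum_mul, hp.2,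
      ← Finset.mul_sum]
    rw [tsallisPotential] at h1
    linarith
  have h0 : ∀ i ∈ Finset.univ,
      0 ≤ (L i + ν) * (√(tsallisWeights t L i) - √(t : ℝ) / (L i + ν)) ^ 2 :=
    fun i _ => mul_nonneg (hν i).le (sq_nonneg _)
  intro i
  have h4 := (Finset.sum_eq_zero_iff_of_nonneg h0).1 (le_antisymm h2 (Finset.sum_nonneg h0)) i
    (Finset.mem_univ i)
  have h5 := pow_eq_zero_iff (two_ne_zero) |>.1 ((mul_eq_zero.1 h4).resolve_left (hν i).ne')
  linarith

lemma tsallisWeights_pos {K : ℕ} [NeZero K] {t : ℕ} (ht : 0 < t) (L : Fin K → ℝ) (i : Fin K) :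
    0 < tsallisWeights t L i := by
  obtain ⟨ν, hν, h⟩ := exists_sqrt_tsallisWeights_eq ht L
  have ht' : (0 : ℝ) < t := by exact_mod_cast ht
  refine Real.sqrt_pos.1 ?_
  rw [h]
  exact div_pos (Real.sqrt_pos.2 ht') (hν i)

lemma tsallisWeights_le_one {K : ℕ} [NeZero K] (t : ℕ) (L : Fin K → ℝ) (i : Fin K) :
    tsallisWeights t L i ≤ 1 := by
  rw [← (tsallisWeights_mem t L).2]
  exact Finset.single_le_sum (fun i _ => (tsallisWeights_mem t L).1 i) (Finset.mem_univ i)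

/-- Stability of the potential under a perturbation `u + δ` of the losses, measured by the
perturbation `u`. -/
lemma tsallisPotential_stability {K : ℕ} [NeZero K] {t : ℕ} (ht : 0 < t) (L u : Fin K → ℝ) (δ : ℝ)
    (hu : ∀ i, 0 < √(t : ℝ) / √(tsallisWeights t L i) + u i) :
    ∑ i, tsallisWeights t L i * u i + δ + tsallisPotential t L
        - tsallisPotential t (fun i => L i + (u i + δ)) ≤
      ∑ i, tsallisWeights t L i * u i ^ 2 / (√(t : ℝ) / √(tsallisWeights t L i) + u i) := by
  obtain ⟨ν, hν, h⟩ := exists_sqrt_tsallisWeights_eq ht L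
  have ht' : (0 : ℝ) < t := by exact_mod_cast ht
  have hs : √(t : ℝ) ≠ 0 := (Real.sqrt_pos.2 ht').ne'
  have hw : ∀ i, √(t : ℝ) / √(tsallisWeights t L i) = L i + ν := fun i => by
    have := (hν i).ne'
    rw [h]; field_simp
  have hp : ∀ i, tsallisWeights t L i = (t : ℝ) / (L i + ν) ^ 2 := fun i => by
    rw [← Real.sq_sqrt ((tsallisWeights_mem t L).1 i), h, div_pow, Real.sq_sqrt ht'.le]
  simp only [hw] at hu ⊢
  -- A constant shift of the losses is absorbed by the multiplier, so only `u` enters the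
  -- denominators.
  have h1 := dual_le_tsallisPotential t (fun i => L i + (u i + δ)) (ν - δ)
    (fun i => by have := hu i; linarith)
  have h2 : tsallisPotential t L = -ν - ∑ i, (t : ℝ) / (L i + ν) := by
    have h3 : -ν = ∑ i, -ν * tsallisWeights t L i := by
      rw [← Finset.mul_sum, (tsallisWeights_mem t L).2, mul_one]
    conv_rhs => rw [h3]
    rw [tsallisPotential, Finset.mul_sum, ← Finset.sum_sub_distrib, ← Finset.sum_sub_distrib]
    refine Finset.sum_congr rfl fun i _ => ?_
    rw [h, hp]
    have h3 := Real.sq_sqrt ht'.le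
    have h4 := (hν i).ne'
    field_simp
    rw [h3]; ring
  have h3 : ∀ i, tsallisWeights t L i * u i ^ 2 / (L i + ν + u i) =
      tsallisWeights t L i * u i - (t : ℝ) / (L i + ν)
        + (t : ℝ) / (L i + (u i + δ) + (ν - δ)) := fun i => by
    have e : L i + (u i + δ) + (ν - δ) = L i + ν + u i := by ring
    have h4 := (hν i).ne'
    have h5 := (hu i).ne'
    rw [e, hp]
    field_simp
    ring
  simp only [h3, Finset.sum_add_distrib, Finset.sum_sub_distrib]
  linarith

/-- Importance-weighted unit loss of arm `k`. -/
def weightedLoss {K : ℕ} [NeZero K] (t : ℕ) (L : Fin K → ℝ) (k i : Fin K) : ℝ :=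
  if i = k then 1 / tsallisWeights t L k else 0

lemma sum_mul_weightedLoss {K : ℕ} [NeZero K] {t : ℕ} (ht : 0 < t) (L : Fin K → ℝ) (k : Fin K) :
    ∑ i, tsallisWeights t L i * weightedLoss t L k i = 1 := by
  simp [weightedLoss, (tsallisWeights_pos ht L k).ne']

/-- Stability without centring. After weighting by the probability of `k` it costs `√p_k / √t`,
which is good enough for every arm except `a`. -/
lemma potential_drop_le {K : ℕ} [NeZero K] {t : ℕ} (ht : 0 < t) (L : Fin K → ℝ) (k : Fin K) :
    1 + tsallisPotential t L - tsallisPotential t (fun i => L i + weightedLoss t L k i) ≤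
      1 / (√(tsallisWeights t L k) * √(t : ℝ)) := by
  have ht' : (0 : ℝ) < √(t : ℝ) := Real.sqrt_pos.2 (by exact_mod_cast ht)
  have hp := tsallisWeights_pos ht L
  have hsp := fun i => Real.sqrt_pos.2 (hp i)
  have hn : ∀ i, 0 ≤ weightedLoss t L k i := fun i => by
    have := (hp k).le
    unfold weightedLoss; split_ifs <;> positivity
  have h := tsallisPotential_stability ht L (weightedLoss t L k) 0 (fun i => by
    have := hn i
    have := hsp i
    positivity)
  rw [sum_mul_weightedLoss ht] at h
  simp only [add_zero] at h
  refine h.trans ?_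
  rw [Finset.sum_eq_single k (fun i _ hi => by simp [weightedLoss, hi]) (by simp)]
  simp only [weightedLoss, if_true]
  have h1 : tsallisWeights t L k * (1 / tsallisWeights t L k) ^ 2 = 1 / tsallisWeights t L k := by
    have := (hp k).ne'
    field_simp
  have h2 := Real.mul_self_sqrt (hp k).le
  rw [h1, div_le_div_iff₀ (by have := hp k; have := hsp k; positivity) (by have := hsp k; positivity),
    one_mul]
  calc 1 / tsallisWeights t L k * (√(tsallisWeights t L k) * √(t : ℝ))
      = √(t : ℝ) / √(tsallisWeights t L k) := by
        nth_rewrite 1 [← h2]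
        have := (hsp k).ne'
        field_simp
    _ ≤ _ := by
        have := hp k
        have : 0 ≤ 1 / tsallisWeights t L k := by positivity
        linarith

/-- For the optimal arm the drop is small once its weight is close to `1`. -/
lemma potential_drop_le_of_four_le {K : ℕ} [NeZero K] {t : ℕ} (ht : 4 ≤ t) (L : Fin K → ℝ)
    (a : Fin K) :
    tsallisWeights t L a *
        (1 + tsallisPotential t L - tsallisPotential t (fun i => L i + weightedLoss t L a i)) ≤
      3 / 2 / √(t : ℝ) * ∑ i ∈ Finset.univ.erase a, √(tsallisWeights t L i) := by
  have ht0 : 0 < t := by omega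
  have ht2 : (2 : ℝ) ≤ √(t : ℝ) := by
    rw [Real.le_sqrt' (by norm_num)]; norm_num; exact_mod_cast ht
  have hp := tsallisWeights_pos ht0 L
  have hsp := fun i => Real.sqrt_pos.2 (hp i)
  have hp1 := tsallisWeights_le_one t L
  have hsq := fun i => Real.sq_sqrt (hp i).le
  have hsp1 : ∀ i, √(tsallisWeights t L i) ≤ 1 := fun i => Real.sqrt_le_one.2 (hp1 i)
  have hw : ∀ i, √(t : ℝ) ≤ √(t : ℝ) / √(tsallisWeights t L i) := fun i => by
    rw [le_div_iff₀ (hsp i)]; nlinarith [hsp1 i]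
  have hn : ∀ i, 0 ≤ weightedLoss t L a i := fun i => by
    have := (hp a).le
    unfold weightedLoss; split_ifs <;> positivity
  -- The estimate is centred by its mean `1`, so arm `a` contributes only through `1 - p_a`.
  -- Perturbed denominators stay positive because `√t ≥ 2`, whence `4 ≤ t`.
  have h := tsallisPotential_stability ht0 L (fun i => weightedLoss t L a i - 1) 1 (fun i => by
    have := hn i
    have := hw i
    linarith)
  simp only [mul_sub, Finset.sum_sub_distrib, sum_mul_weightedLoss ht0, mul_one,
    (tsallisWeights_mem t L).2, sub_add_cancel, sub_self, zero_add] at h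
  have hsum : ∑ i ∈ Finset.univ.erase a, tsallisWeights t L i = 1 - tsallisWeights t L a := by
    have := Finset.add_sum_erase Finset.univ (fun i => tsallisWeights t L i) (Finset.mem_univ a)
    rw [(tsallisWeights_mem t L).2] at this
    linarith
  refine (mul_le_mul_of_nonneg_left h (hp a).le).trans ?_
  rw [← Finset.add_sum_erase _ _ (Finset.mem_univ a), mul_add, Finset.mul_sum, Finset.mul_sum]
  have hA : tsallisWeights t L a * (tsallisWeights t L a * (weightedLoss t L a a - 1) ^ 2 /
      (√(t : ℝ) / √(tsallisWeights t L a) + (weightedLoss t L a a - 1))) ≤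
      ∑ i ∈ Finset.univ.erase a, tsallisWeights t L i / √(t : ℝ) := by
    rw [← Finset.sum_div, hsum]
    have e1 : weightedLoss t L a a - 1 = (1 - tsallisWeights t L a) / tsallisWeights t L a := by
      have := (hp a).ne'
      simp only [weightedLoss, if_true]; field_simp
    have h0 : 0 ≤ (1 - tsallisWeights t L a) / tsallisWeights t L a :=
      div_nonneg (by linarith [hp1 a]) (hp a).le
    rw [e1, ← mul_div_assoc]
    have e2 : tsallisWeights t L a * (tsallisWeights t L a *
        ((1 - tsallisWeights t L a) / tsallisWeights t L a) ^ 2) =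
        (1 - tsallisWeights t L a) ^ 2 := by
      have := (hp a).ne'
      field_simp
    rw [e2]
    have h1 := hp1 a
    have h2 := hp a
    exact div_le_div₀ (by linarith) (by nlinarith) (by linarith) (by linarith [hw a])
  -- The subtracted term `p_i / √t` pays for the contribution of `a` bounded in `hA`.
  have hB : ∀ i ∈ Finset.univ.erase a,
      tsallisWeights t L a * (tsallisWeights t L i * (weightedLoss t L a i - 1) ^ 2 /
      (√(t : ℝ) / √(tsallisWeights t L i) + (weightedLoss t L a i - 1))) ≤
      3 / 2 / √(t : ℝ) * √(tsallisWeights t L i) - tsallisWeights t L i / √(t : ℝ) := by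
    intro i hi
    have hia : i ≠ a := Finset.ne_of_mem_erase hi
    have e1 : weightedLoss t L a i - 1 = -1 := by simp [weightedLoss, hia]
    have h1 : √(t : ℝ) / √(tsallisWeights t L i) / 2 ≤
        √(t : ℝ) / √(tsallisWeights t L i) + -1 := by linarith [hw i]
    have h2 : tsallisWeights t L a ≤ 1 - tsallisWeights t L i := by
      have := Finset.single_le_sum (f := fun i => tsallisWeights t L i) (fun i _ => (hp i).le) hi
      linarith
    rw [e1]
    have h3 : tsallisWeights t L i * (-1) ^ 2 / (√(t : ℝ) / √(tsallisWeights t L i) + -1) ≤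
        tsallisWeights t L i * (-1) ^ 2 / (√(t : ℝ) / √(tsallisWeights t L i) / 2) := by
      have := hp i
      have := hsp i
      gcongr
    have h4 : tsallisWeights t L i * (-1) ^ 2 / (√(t : ℝ) / √(tsallisWeights t L i) / 2) =
        2 * √(tsallisWeights t L i) ^ 3 / √(t : ℝ) := by
      nth_rewrite 1 [← hsq i]
      have := (hsp i).ne'
      field_simp
    rw [h4] at h3
    have h5 : 0 ≤ 2 * √(tsallisWeights t L i) ^ 3 / √(t : ℝ) := by
      have := hsp i
      positivity
    refine (mul_le_mul h2 h3 ?_ (by linarith [hp1 i])).trans ?_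
    · rw [neg_one_sq, mul_one]
      exact div_nonneg (hp i).le (by linarith [hw i])
    · set s := √(tsallisWeights t L i) with hs
      rw [← hsq i, ← hs]
      have h6 := hsp1 i
      have h7 := hsp i
      rw [← hs] at h6 h7
      have h8 : (1 - s ^ 2) * (2 * s ^ 3) ≤ 3 / 2 * s - s ^ 2 := by
        have : 0 ≤ s * ((1 - s) * (3 / 2 - s * 0) + s / 2 - 2 * s ^ 2 * (1 - s ^ 2)) := by
          refine mul_nonneg h7.le ?_
          nlinarith [sq_nonneg (s - 1), sq_nonneg (s ^ 2 - 1 / 2), mul_nonneg h7.le (sub_nonneg.2 h6)]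
        nlinarith
      calc (1 - s ^ 2) * (2 * s ^ 3 / √(t : ℝ)) = ((1 - s ^ 2) * (2 * s ^ 3)) / √(t : ℝ) := by ring
        _ ≤ (3 / 2 * s - s ^ 2) / √(t : ℝ) := by gcongr
        _ = _ := by ring
  have hC := Finset.sum_le_sum hB
  rw [Finset.sum_sub_distrib] at hC
  linarith

/-! ### One round of a single player -/

/-- Potential of a player, normalized by the cumulative loss of the arm `a`. -/
def playerPotential {K : ℕ} [NeZero K] (a : Fin K) (t : ℕ) (L : Fin K → ℝ) : ℝ :=
  tsallisPotential t L - L a + 2 * √(t : ℝ)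

/-- The vertex at `a` is a competitor in the minimum; the summand `2√t` compensates its regularizer.
-/
lemma playerPotential_nonpos {K : ℕ} [NeZero K] (a : Fin K) (t : ℕ) (L : Fin K → ℝ) :
    playerPotential a t L ≤ 0 := by
  have h := tsallisPotential_le t L (single_mem_stdSimplex ℝ a)
  have h1 : ∀ k, √((Pi.single a (1 : ℝ) : Fin K → ℝ) k) = if k = a then 1 else 0 := fun k => by
    by_cases hk : k = a <;> simp [hk]
  simp only [h1] at h
  simp [Pi.single_apply] at h
  rw [playerPotential]
  linarith

lemma playerPotential_zero {K : ℕ} [NeZero K] (a : Fin K) :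
    playerPotential a 0 (fun _ => 0) = 0 := by
  simp [playerPotential, tsallisPotential]

/-- Bound on the expected regret of one player in round `t`, up to the change of potential. -/
def playerError {K : ℕ} [NeZero K] (a : Fin K) (t : ℕ) (L : Fin K → ℝ) : ℝ :=
  4 / √(t : ℝ) * ∑ i ∈ Finset.univ.erase a, √(tsallisWeights t L i) + 2 / t

lemma sqrt_succ_sub_sqrt_le (n : ℕ) :
    2 * (√((n + 1 : ℕ) : ℝ) - √(n : ℝ)) ≤ 2 / √((n + 1 : ℕ) : ℝ) := by
  have h1 : 0 < √((n + 1 : ℕ) : ℝ) := Real.sqrt_pos.2 (by positivity)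
  have h2 : √((n + 1 : ℕ) : ℝ) ^ 2 = n + 1 := by
    rw [Real.sq_sqrt (by positivity)]; push_cast; ring
  have h3 : √(n : ℝ) ^ 2 = n := Real.sq_sqrt (by positivity)
  have h4 : √(n : ℝ) ≤ √((n + 1 : ℕ) : ℝ) := Real.sqrt_le_sqrt (by push_cast; linarith)
  rw [le_div_iff₀ h1]
  nlinarith [Real.sqrt_nonneg (n : ℝ)]

lemma sqrt_succ_sub_sqrt_le_of_three_le {n : ℕ} (hn : 3 ≤ n) :
    2 * (√((n + 1 : ℕ) : ℝ) - √(n : ℝ)) ≤ 3 / 2 / √((n + 1 : ℕ) : ℝ) := by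
  have h1 : 0 < √((n + 1 : ℕ) : ℝ) := Real.sqrt_pos.2 (by positivity)
  have h2 : √((n + 1 : ℕ) : ℝ) ^ 2 = n + 1 := by
    rw [Real.sq_sqrt (by positivity)]; push_cast; ring
  have h3 : √(n : ℝ) ^ 2 = n := Real.sq_sqrt (by positivity)
  have hn' : (3 : ℝ) ≤ n := by exact_mod_cast hn
  -- After multiplication by `√(n+1)` the claim reads `2 (n + 1 - √(n (n+1))) ≤ 3/2`.
  have h4 : (n : ℝ) + 1 / 4 ≤ √((n + 1 : ℕ) : ℝ) * √(n : ℝ) := by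
    refine abs_le_of_sq_le_sq' ?_ (by positivity) |>.2
    rw [mul_pow, h2, h3]; nlinarith
  rw [le_div_iff₀ h1]
  nlinarith

/-- Total cost of a round: stability, plus the penalty for the change of learning rate. In the
penalty the `-1` cancels `√p_a ≤ 1`, so again only suboptimal arms remain. -/
lemma sum_mul_potential_drop_le {K : ℕ} [NeZero K] (n : ℕ) (L : Fin K → ℝ) (a : Fin K)
    (c : Fin K → ℝ) (hc0 : ∀ k, 0 ≤ c k) (hc1 : ∀ k, c k ≤ 1) :
    ∑ k, tsallisWeights (n + 1) L k * c k * (1 + tsallisPotential (n + 1) L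
        - tsallisPotential (n + 1) (fun i => L i + weightedLoss (n + 1) L k i))
      + 2 * (√((n + 1 : ℕ) : ℝ) - √(n : ℝ)) *
        (∑ k, √(tsallisWeights (n + 1) L k) - 1) ≤ playerError a (n + 1) L := by
  have ht : 0 < n + 1 := n.succ_pos
  have hs : 0 < √((n + 1 : ℕ) : ℝ) := Real.sqrt_pos.2 (by positivity)
  have hp := tsallisWeights_pos ht L
  have hsp := fun i => Real.sqrt_pos.2 (hp i)
  have hsa : √(tsallisWeights (n + 1) L a) ≤ 1 :=
    Real.sqrt_le_one.2 (tsallisWeights_le_one _ L a)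
  have hdrop : ∀ k, tsallisWeights (n + 1) L k * (1 + tsallisPotential (n + 1) L
        - tsallisPotential (n + 1) (fun i => L i + weightedLoss (n + 1) L k i)) ≤
        1 / √((n + 1 : ℕ) : ℝ) * √(tsallisWeights (n + 1) L k) := fun k => by
    refine (mul_le_mul_of_nonneg_left (potential_drop_le ht L k) (hp k).le).trans_eq ?_
    have h := Real.sq_sqrt (hp k).le
    have := (hsp k).ne'
    nth_rewrite 1 [← h]
    field_simp
  have hscale : ∀ k b, 0 ≤ b → tsallisWeights (n + 1) L k * (1 + tsallisPotential (n + 1) L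
        - tsallisPotential (n + 1) (fun i => L i + weightedLoss (n + 1) L k i)) ≤ b →
      tsallisWeights (n + 1) L k * c k * (1 + tsallisPotential (n + 1) L
        - tsallisPotential (n + 1) (fun i => L i + weightedLoss (n + 1) L k i)) ≤ b := by
    intro k b hb h
    have h1 := mul_le_mul_of_nonneg_left h (hc0 k)
    have h2 := mul_le_mul_of_nonneg_right (hc1 k) hb
    linarith
  have hQ : 0 ≤ ∑ i ∈ Finset.univ.erase a, √(tsallisWeights (n + 1) L i) :=
    Finset.sum_nonneg fun i _ => Real.sqrt_nonneg _
  have hother : ∑ k ∈ Finset.univ.erase a, tsallisWeights (n + 1) L k * c k *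
      (1 + tsallisPotential (n + 1) L
        - tsallisPotential (n + 1) (fun i => L i + weightedLoss (n + 1) L k i)) ≤
      1 / √((n + 1 : ℕ) : ℝ) * ∑ i ∈ Finset.univ.erase a, √(tsallisWeights (n + 1) L i) := by
    rw [Finset.mul_sum]
    exact Finset.sum_le_sum fun k _ => hscale k _ (by positivity) (hdrop k)
  rw [← Finset.add_sum_erase _ _ (Finset.mem_univ a),
    ← Finset.add_sum_erase _ (fun k => √(tsallisWeights (n + 1) L k)) (Finset.mem_univ a),
    playerError]
  have hmono : √(n : ℝ) ≤ √((n + 1 : ℕ) : ℝ) := Real.sqrt_le_sqrt (by push_cast; linarith)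
  set Q := ∑ i ∈ Finset.univ.erase a, √(tsallisWeights (n + 1) L i) with hQdef
  have hpen : 2 * (√((n + 1 : ℕ) : ℝ) - √(n : ℝ)) * (√(tsallisWeights (n + 1) L a) + Q - 1) ≤
      2 * (√((n + 1 : ℕ) : ℝ) - √(n : ℝ)) * Q :=
    mul_le_mul_of_nonneg_left (by linarith) (by linarith)
  -- From round `4` on, the coefficient is `1 + 3/2 + 3/2 = 4`: other arms, arm `a`, penalty. Before
  -- that, arm `a` gets the crude bound `1 / √t ≤ 2 / t`, the origin of the `2 / t` in
  -- `playerError`.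
  by_cases hn : 3 ≤ n
  · have hA := hscale a _ (by positivity) (potential_drop_le_of_four_le (t := n + 1) (by omega) L a)
    rw [← hQdef] at hA
    have hB := mul_le_mul_of_nonneg_right (sqrt_succ_sub_sqrt_le_of_three_le hn) hQ
    have e : 4 / √((n + 1 : ℕ) : ℝ) * Q = 1 / √((n + 1 : ℕ) : ℝ) * Q
        + 3 / 2 / √((n + 1 : ℕ) : ℝ) * Q + 3 / 2 / √((n + 1 : ℕ) : ℝ) * Q := by ring
    have h0 : (0 : ℝ) ≤ 2 / ((n + 1 : ℕ) : ℝ) := by positivity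
    linarith
  · have hA := hscale a _ (by positivity) (hdrop a)
    have hB := mul_le_mul_of_nonneg_right (sqrt_succ_sub_sqrt_le n) hQ
    have e : 4 / √((n + 1 : ℕ) : ℝ) * Q = 1 / √((n + 1 : ℕ) : ℝ) * Q
        + 2 / √((n + 1 : ℕ) : ℝ) * Q + 1 / √((n + 1 : ℕ) : ℝ) * Q := by ring
    have h0 : 0 ≤ 1 / √((n + 1 : ℕ) : ℝ) * Q := by positivity
    have h1 : 1 / √((n + 1 : ℕ) : ℝ) * √(tsallisWeights (n + 1) L a) ≤ 2 / ((n + 1 : ℕ) : ℝ) := by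
      have h2 : √((n + 1 : ℕ) : ℝ) ≤ 2 := by
        rw [Real.sqrt_le_left (by norm_num)]
        have : n + 1 ≤ 4 := by omega
        have : ((n + 1 : ℕ) : ℝ) ≤ 4 := by exact_mod_cast this
        linarith
      have h3 : 1 / √((n + 1 : ℕ) : ℝ) ≤ 2 / ((n + 1 : ℕ) : ℝ) := by
        rw [div_le_div_iff₀ hs (by positivity)]
        have := Real.sq_sqrt (Nat.cast_nonneg (α := ℝ) (n + 1))
        nlinarith
      have h4 : 0 ≤ 1 / √((n + 1 : ℕ) : ℝ) := by positivity
      nlinarith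
    linarith

/-- One round of a player whose arm `k` suffers loss `1` with probability `c k`. -/
lemma player_regret_le {K : ℕ} [NeZero K] (n : ℕ) (L : Fin K → ℝ) (a : Fin K)
    (c : Fin K → ℝ) (hc0 : ∀ k, 0 ≤ c k) (hc1 : ∀ k, c k ≤ 1) :
    ∑ k, tsallisWeights (n + 1) L k * c k - c a ≤
      ∑ k, tsallisWeights (n + 1) L k *
          (c k * playerPotential a (n + 1) (fun i => L i + weightedLoss (n + 1) L k i)
            + (1 - c k) * playerPotential a (n + 1) L)
        - playerPotential a n L + playerError a (n + 1) L := by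
  have h := sum_mul_potential_drop_le n L a c hc0 hc1
  have hp := tsallisWeights_mem (n + 1) L
  -- The new weights compete in the old problem, which bounds the potential change due to the
  -- learning rate. This also covers `n = 0`, where the regularizer vanishes.
  have hpen := tsallisPotential_le n L hp
  have hcur : tsallisPotential (n + 1) L = ∑ k, tsallisWeights (n + 1) L k * L k
    - 2 * √((n + 1 : ℕ) : ℝ) * ∑ k, √(tsallisWeights (n + 1) L k) := rfl
  -- Unbiasedness of importance weighting.
  have hloss : ∑ k, tsallisWeights (n + 1) L k * c k * weightedLoss (n + 1) L k a = c a := by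
    have := (tsallisWeights_pos n.succ_pos L a).ne'
    simp only [weightedLoss, mul_ite, mul_zero, Finset.sum_ite_eq, Finset.mem_univ, if_true]
    field_simp
  have e : ∀ k, tsallisWeights (n + 1) L k *
          (c k * playerPotential a (n + 1) (fun i => L i + weightedLoss (n + 1) L k i)
            + (1 - c k) * playerPotential a (n + 1) L) =
      tsallisWeights (n + 1) L k * c k
      - tsallisWeights (n + 1) L k * c k * (1 + tsallisPotential (n + 1) L
        - tsallisPotential (n + 1) (fun i => L i + weightedLoss (n + 1) L k i))
      - tsallisWeights (n + 1) L k * c k * weightedLoss (n + 1) L k a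
      + tsallisWeights (n + 1) L k * playerPotential a (n + 1) L := fun k => by
    simp only [playerPotential]; ring
  simp only [e, Finset.sum_add_distrib, Finset.sum_sub_distrib, hloss, ← Finset.sum_mul, hp.2]
  simp only [playerPotential]
  linarith

/-! ### Expectations -/

lemma expect_bind {Ω Ω' : Type} [Fintype Ω] [Fintype Ω'] (μ : PMF Ω) (f : Ω → PMF Ω')
    (X : Ω' → ℝ) : expect (μ.bind f) X = expect μ (fun ω => expect (f ω) X) := by
  have h : ∀ ω', ((μ.bind f) ω').toReal = ∑ ω, (μ ω).toReal * (f ω ω').toReal := fun ω' => by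
    rw [PMF.bind_apply, tsum_fintype, ENNReal.toReal_sum
      (fun ω _ => ENNReal.mul_ne_top (μ.apply_ne_top _) ((f ω).apply_ne_top _))]
    simp only [ENNReal.toReal_mul]
  simp only [expect, h, Finset.sum_mul, Finset.mul_sum]
  rw [Finset.sum_comm]
  simp only [mul_assoc]

lemma expect_pure {Ω : Type} [Fintype Ω] (ω : Ω) (X : Ω → ℝ) : expect (PMF.pure ω) X = X ω := by
  classical
  rw [expect, Finset.sum_eq_single ω (fun b _ hb => by simp [PMF.pure_apply, hb]) (by simp)]
  simp

lemma expect_map {Ω Ω' : Type} [Fintype Ω] [Fintype Ω'] (μ : PMF Ω) (g : Ω → Ω')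
    (X : Ω' → ℝ) : expect (μ.map g) X = expect μ (fun ω => X (g ω)) := by
  rw [PMF.map, expect_bind]
  simp only [Function.comp, expect_pure]

lemma sum_toReal {Ω : Type} [Fintype Ω] (μ : PMF Ω) : ∑ ω, (μ ω).toReal = 1 := by
  rw [← ENNReal.toReal_sum (fun ω _ => μ.apply_ne_top ω), ← tsum_fintype (L := .unconditional Ω),
    μ.tsum_coe, ENNReal.toReal_one]

lemma expect_const {Ω : Type} [Fintype Ω] (μ : PMF Ω) (c : ℝ) : expect μ (fun _ => c) = c := by
  rw [expect, ← Finset.sum_mul, sum_toReal, one_mul]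

lemma expect_add {Ω : Type} [Fintype Ω] (μ : PMF Ω) (X Y : Ω → ℝ) :
    expect μ (fun ω => X ω + Y ω) = expect μ X + expect μ Y := by
  simp only [expect, mul_add, Finset.sum_add_distrib]

lemma expect_const_mul {Ω : Type} [Fintype Ω] (μ : PMF Ω) (c : ℝ) (X : Ω → ℝ) :
    expect μ (fun ω => c * X ω) = c * expect μ X := by
  simp only [expect, Finset.mul_sum]
  exact Finset.sum_congr rfl fun _ _ => by ring

lemma expect_mono {Ω : Type} [Fintype Ω] (μ : PMF Ω) {X Y : Ω → ℝ} (h : ∀ ω, X ω ≤ Y ω) :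
    expect μ X ≤ expect μ Y :=
  Finset.sum_le_sum fun ω _ => mul_le_mul_of_nonneg_left (h ω) ENNReal.toReal_nonneg

/-! ### One round of MetaDueling -/

lemma expect_roundLaw {K m : ℕ} (hm : 2 ≤ m) (D : DuelingAlgorithm K) (P : PrefMatrix K)
    (H : List (Duel K)) (X : Round K m → ℝ) :
    expect (roundLaw hm D P H) X = ∑ x, (D.q₁ H x).toReal * ∑ y, (D.q₂ H y).toReal *
      expect (PMF.uniformOfFintype Bool) (fun b =>
        expect (winnerLaw hm P (playedArms m x y b)) (fun w => X (x, y, b, w))) := by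
  rw [roundLaw, expect_bind]
  simp only [expect_bind, expect_map]
  rfl

lemma expect_coin (X : Bool → ℝ) :
    expect (PMF.uniformOfFintype Bool) X = 1 / 2 * (X true + X false) := by
  simp [expect, PMF.uniformOfFintype_apply]
  ring

lemma countFirst_le (m : ℕ) (b : Bool) : countFirst m b ≤ m := by
  unfold countFirst
  split_ifs with h h'
  · omega
  · rw [Nat.not_even_iff_odd] at h; obtain ⟨k, rfl⟩ := h; omega
  · omega

lemma countFirst_even {m : ℕ} (h : Even m) (b : Bool) : (countFirst m b : ℝ) = m / 2 := by
  obtain ⟨k, rfl⟩ := h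
  have : countFirst (k + k) b = k := by simp [countFirst]; omega
  rw [this]; push_cast; ring

lemma countFirst_odd {m : ℕ} (h : ¬ Even m) :
    (countFirst m true : ℝ) = (m + 1) / 2 ∧ (countFirst m false : ℝ) = (m - 1) / 2 := by
  obtain ⟨k, rfl⟩ := Nat.not_even_iff_odd.1 h
  have h1 : countFirst (2 * k + 1) true = k + 1 := by simp [countFirst]; omega
  have h2 : countFirst (2 * k + 1) false = k := by simp [countFirst]; omega
  rw [h1, h2]; push_cast
  exact ⟨by ring, by ring⟩

lemma sum_ite_val_lt {m n : ℕ} (hn : n ≤ m) (u v : ℝ) :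
    ∑ j : Fin m, (if j.val < n then u else v) = n * u + (m - n) * v := by
  obtain ⟨k, rfl⟩ := Nat.exists_eq_add_of_le hn
  rw [Fin.sum_univ_add]
  simp

lemma expect_gap_arms {K m : ℕ} (hm : 2 ≤ m) (P : PrefMatrix K) (a x y : Fin K) :
    expect (PMF.uniformOfFintype Bool) (fun b =>
        expect (winnerLaw hm P (playedArms m x y b)) (fun w =>
          1 / (m : ℝ) * ∑ j : Fin m, gap P a (Round.arms ((x, y, b, w) : Round K m) j))) =
      1 / 2 * (gap P a x + gap P a y) := by
  have hm0 : (m : ℝ) ≠ 0 := by positivity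
  have h : ∀ b w, ∑ j : Fin m, gap P a (Round.arms ((x, y, b, w) : Round K m) j) =
      countFirst m b * gap P a x + (m - countFirst m b) * gap P a y := fun b w => by
    rw [← sum_ite_val_lt (countFirst_le m b)]
    refine Finset.sum_congr rfl fun j _ => ?_
    exact apply_ite (gap P a) _ _ _
  simp only [h, expect_const, expect_coin]
  by_cases he : Even m
  · simp only [countFirst_even he]
    field_simp; ring
  · rw [(countFirst_odd he).1, (countFirst_odd he).2]
    field_simp; ring

lemma sum_winProb_first {K m : ℕ} (P : PrefMatrix K) (x y : Fin K) (b : Bool) :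
    ∑ w : Fin m, (if w.val < countFirst m b then winProb P (playedArms m x y b) w else 0) =
      countFirst m b * (2 / ((m : ℝ) * ((m : ℝ) - 1)) *
        (countFirst m b * (1 / 2) + (m - countFirst m b) * P.val x y - 1 / 2)) := by
  set n := countFirst m b with hn
  have hnm : n ≤ m := countFirst_le m b
  have h : ∀ w : Fin m, (if w.val < n then winProb P (playedArms m x y b) w else 0) =
      if w.val < n then 2 / ((m : ℝ) * ((m : ℝ) - 1)) *
        (n * (1 / 2) + (m - n) * P.val x y - 1 / 2) else 0 := by
    intro w
    split_ifs with hw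
    · have hx : playedArms m x y b w = x := by simp [playedArms, ← hn, hw]
      have h2 := Finset.add_sum_erase Finset.univ
        (fun j => P.val x (playedArms m x y b j)) (Finset.mem_univ w)
      have h3 : ∑ j, P.val x (playedArms m x y b j) = n * (1 / 2) + (m - n) * P.val x y := by
        rw [← sum_ite_val_lt hnm]
        refine Finset.sum_congr rfl fun j _ => ?_
        simp only [playedArms, ← hn]
        split_ifs
        · exact P.self x
        · rfl
      simp only [hx, P.self, h3] at h2
      rw [winProb, hx, ← h2, add_sub_cancel_left, Finset.mul_sum]
      exact Finset.sum_congr rfl fun j _ => by ring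
    · rfl
  simp only [h]
  rw [sum_ite_val_lt hnm]
  ring

/-- The base algorithm faces the rescaled preference matrix. -/
lemma expect_duel {K m : ℕ} (hm : 2 ≤ m) (P : PrefMatrix K) (x y : Fin K) (G : Bool → ℝ) :
    expect (PMF.uniformOfFintype Bool) (fun b =>
        expect (winnerLaw hm P (playedArms m x y b)) (fun w =>
          G (decide (w.val < countFirst m b)))) =
      rescaledPref m P x y * G true + (1 - rescaledPref m P x y) * G false := by
  have h2 : (2 : ℝ) ≤ m := by exact_mod_cast hm
  have hm0 : (m : ℝ) ≠ 0 := by linarith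
  have hm1 : (m : ℝ) - 1 ≠ 0 := by linarith
  have h : ∀ b, expect (winnerLaw hm P (playedArms m x y b)) (fun w =>
          G (decide (w.val < countFirst m b))) =
      (countFirst m b * (2 / ((m : ℝ) * ((m : ℝ) - 1)) *
        (countFirst m b * (1 / 2) + (m - countFirst m b) * P.val x y - 1 / 2))) *
          (G true - G false) + G false := fun b => by
    have e : ∀ w : Fin m, (winnerLaw hm P (playedArms m x y b) w).toReal *
        G (decide (w.val < countFirst m b)) =
        (if w.val < countFirst m b then winProb P (playedArms m x y b) w else 0) *
          (G true - G false) + winProb P (playedArms m x y b) w * G false := fun w => by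
      rw [winnerLaw, PMF.ofFintype_apply, ENNReal.toReal_ofReal (winProb_nonneg hm P _ w)]
      by_cases hw : w.val < countFirst m b
      · simp only [hw, decide_true, if_true]; ring
      · simp [hw]
    simp only [expect, e]
    rw [Finset.sum_add_distrib, ← Finset.sum_mul, ← Finset.sum_mul, sum_winProb_first,
      sum_winProb hm, one_mul]
  -- For odd `m` neither split alone gives probability `1/2` at a tie; the average over the coin
  -- does, and it equals `α_m + β_m P`.
  simp only [h, expect_coin, rescaledPref, rescaleAlpha, rescaleBeta]
  by_cases he : Even m
  · simp only [countFirst_even he, he, if_true]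
    field_simp; ring
  · rw [(countFirst_odd he).1, (countFirst_odd he).2]
    simp only [he, if_false]
    field_simp; ring

/-! ### Rescaled preferences -/

lemma rescaleBeta_mem {m : ℕ} (hm : 2 ≤ m) : 1 / 2 ≤ rescaleBeta m ∧ rescaleBeta m ≤ 1 := by
  have h2 : (2 : ℝ) ≤ m := by exact_mod_cast hm
  unfold rescaleBeta
  split_ifs
  · rw [div_le_div_iff₀ (by norm_num) (by linarith), div_le_one (by linarith)]
    constructor <;> linarith
  · rw [div_le_div_iff₀ (by norm_num) (by linarith), div_le_one (by linarith)]
    constructor <;> linarith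

lemma rescaledGap_eq {K : ℕ} (m : ℕ) (P : PrefMatrix K) (a i : Fin K) :
    rescaledGap m P a i = rescaleBeta m * gap P a i := by
  simp only [rescaledGap, rescaledPref, rescaleAlpha, gap]; ring

lemma rescaledGap_self {K : ℕ} (m : ℕ) (P : PrefMatrix K) (a : Fin K) :
    rescaledGap m P a a = 0 := by
  rw [rescaledGap_eq, gap, P.self, sub_self, mul_zero]

lemma rescaledPref_add {K : ℕ} (m : ℕ) (P : PrefMatrix K) (i j : Fin K) :
    rescaledPref m P i j + rescaledPref m P j i = 1 := by
  have h := P.reciprocal j i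
  simp only [rescaledPref, rescaleAlpha]
  linear_combination rescaleBeta m * h

lemma rescaledPref_mem {K m : ℕ} (hm : 2 ≤ m) (P : PrefMatrix K) (i j : Fin K) :
    0 ≤ rescaledPref m P i j ∧ rescaledPref m P i j ≤ 1 := by
  have h := rescaleBeta_mem hm
  have h1 : ∀ i j, 0 ≤ rescaledPref m P i j := fun i j => by
    have := mul_nonneg (by linarith : 0 ≤ rescaleBeta m) (P.nonneg i j)
    simp only [rescaledPref, rescaleAlpha]
    linarith
  have := rescaledPref_add m P i j
  exact ⟨h1 i j, by linarith [h1 j i]⟩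

/-! ### Trajectories -/

section Trajectory

variable {K m : ℕ} (hm : 2 ≤ m) (D : DuelingAlgorithm K) (P : PrefMatrix K)

lemma expect_metaDuelingLaw_succ (T : ℕ) (X : (Fin (T + 1) → Round K m) → ℝ) :
    expect (metaDuelingLaw hm D (fun _ => P) (T + 1)) X =
      expect (metaDuelingLaw hm D (fun _ => P) T) (fun h =>
        expect (roundLaw hm D P (baseHistory T h)) (fun r =>
          X (Fin.snoc (α := fun _ => Round K m) h r))) := by
  rw [metaDuelingLaw, expect_bind]
  simp only [expect_map]

lemma pastDuels_snoc_castSucc {T : ℕ} (h : Fin T → Round K m) (r : Round K m) (t : Fin T) :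
    pastDuels (Fin.snoc (α := fun _ => Round K m) h r) t.castSucc = pastDuels h t := by
  unfold pastDuels
  congr 1
  funext s
  exact Fin.snoc_castSucc (α := fun _ => Round K m) r h (s.castLE t.isLt.le)

lemma pastDuels_snoc_last {T : ℕ} (h : Fin T → Round K m) (r : Round K m) :
    pastDuels (Fin.snoc (α := fun _ => Round K m) h r) (Fin.last T) = baseHistory T h := by
  unfold pastDuels
  congr 1
  funext s
  exact Fin.snoc_castSucc (α := fun _ => Round K m) r h s

lemma baseHistory_snoc {T : ℕ} (h : Fin T → Round K m) (r : Round K m) :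
    baseHistory (T + 1) (Fin.snoc (α := fun _ => Round K m) h r) =
      r.duel :: baseHistory T h := by
  rw [baseHistory, Fin.snoc_last]
  congr 2
  funext s
  exact Fin.snoc_castSucc (α := fun _ => Round K m) r h s

lemma length_baseHistory (T : ℕ) (h : Fin T → Round K m) : (baseHistory T h).length = T := by
  induction T with
  | zero => rfl
  | succ T ih => rw [baseHistory, List.length_cons, ih]

/-- Each summand may be replaced by its conditional expectation given the past. -/
lemma expect_sum_eq_expect_sum_condexp (f : List (Duel K) → Round K m → ℝ) (F : List (Duel K) → ℝ)
    (hF : ∀ H, expect (roundLaw hm D P H) (f H) = F H) (T : ℕ) :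
    expect (metaDuelingLaw hm D (fun _ => P) T) (fun h => ∑ t, f (pastDuels h t) (h t)) =
      expect (metaDuelingLaw hm D (fun _ => P) T) (fun h => ∑ t, F (pastDuels h t)) := by
  induction T with
  | zero => simp
  | succ T ih =>
    simp only [expect_metaDuelingLaw_succ, Fin.sum_univ_castSucc, pastDuels_snoc_castSucc,
      pastDuels_snoc_last, Fin.snoc_castSucc, Fin.snoc_last, expect_add, expect_const, hF, ih]

/-- Summation of a one-step drift inequality. -/
lemma expect_sum_le_of_drift (F W : List (Duel K) → ℝ) (c : ℕ → ℝ)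
    (hF : ∀ H, F H ≤ expect (roundLaw hm D P H) (fun r : Round K m => W (r.duel :: H)) - W H
      + c H.length) (T : ℕ) :
    expect (metaDuelingLaw hm D (fun _ => P) T) (fun h => ∑ t, F (pastDuels h t)) ≤
      expect (metaDuelingLaw hm D (fun _ => P) T) (fun h => W (baseHistory T h)) - W []
        + ∑ t ∈ Finset.range T, c t := by
  induction T with
  | zero => simp [baseHistory, expect_const]
  | succ T ih =>
    simp only [expect_metaDuelingLaw_succ, Fin.sum_univ_castSucc, pastDuels_snoc_castSucc,
      pastDuels_snoc_last, expect_add, expect_const, baseHistory_snoc, Finset.sum_range_succ]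
    have h := expect_mono (metaDuelingLaw hm D (fun _ => P) T) (fun h => hF (baseHistory T h))
    simp only [length_baseHistory, sub_eq_add_neg, expect_add, expect_const] at h
    have h1 := expect_const_mul (metaDuelingLaw hm D (fun _ => P) T) (-1)
      (fun h => W (baseHistory T h))
    simp only [neg_one_mul] at h1
    linarith

/-- Expected instantaneous gap of the two players. -/
def meanGap (g : Fin K → ℝ) (H : List (Duel K)) : ℝ :=
  1 / 2 * ∑ i, ((D.q₁ H i).toReal + (D.q₂ H i).toReal) * g i

lemma sum_sum_mul_add {ι : Type*} [Fintype ι] {p q : ι → ℝ} (hp : ∑ i, p i = 1)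
    (hq : ∑ i, q i = 1) (g : ι → ℝ) :
    ∑ x, p x * ∑ y, q y * (1 / 2 * (g x + g y)) = 1 / 2 * ∑ i, (p i + q i) * g i := by
  have h : ∀ x, p x * ∑ y, q y * (1 / 2 * (g x + g y)) =
      p x * (1 / 2 * g x) + p x * (1 / 2 * ∑ y, q y * g y) := fun x => by
    have h1 : ∑ y, q y * (1 / 2 * (g x + g y)) =
        (∑ y, q y) * (1 / 2 * g x) + 1 / 2 * ∑ y, q y * g y := by
      rw [Finset.sum_mul, Finset.mul_sum, ← Finset.sum_add_distrib]
      exact Finset.sum_congr rfl fun y _ => by ring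
    rw [h1, hq]; ring
  simp only [h]
  rw [Finset.sum_add_distrib, ← Finset.sum_mul, hp, one_mul, Finset.mul_sum, Finset.mul_sum,
    ← Finset.sum_add_distrib]
  exact Finset.sum_congr rfl fun i _ => by ring

lemma expect_baseRegret (a : Fin K) (T : ℕ) :
    expect (metaDuelingLaw hm D (fun _ => P) T) (baseRegret (fun _ => P) a) =
      expect (metaDuelingLaw hm D (fun _ => P) T)
        (fun h => ∑ t, meanGap D (rescaledGap m P a) (pastDuels h t)) := by
  refine expect_sum_eq_expect_sum_condexp hm D P
    (fun _ r => 1 / 2 * (rescaledGap m P a r.x + rescaledGap m P a r.y)) _ (fun H => ?_) T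
  rw [expect_roundLaw, meanGap, ← sum_sum_mul_add (sum_toReal _) (sum_toReal _)]
  simp only [Round.x, Round.y, expect_const]

lemma expect_condorcetRegret (a : Fin K) (T : ℕ) :
    expect (metaDuelingLaw hm D (fun _ => P) T) (condorcetRegret (fun _ => P) a) =
      expect (metaDuelingLaw hm D (fun _ => P) T)
        (fun h => ∑ t, meanGap D (gap P a) (pastDuels h t)) := by
  refine expect_sum_eq_expect_sum_condexp hm D P
    (fun _ r => 1 / (m : ℝ) * ∑ j : Fin m, gap P a (r.arms j)) _ (fun H => ?_) T
  rw [expect_roundLaw, meanGap, ← sum_sum_mul_add (sum_toReal _) (sum_toReal _)]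
  simp only [expect_gap_arms]

lemma meanGap_rescaledGap (a : Fin K) (H : List (Duel K)) :
    meanGap D (rescaledGap m P a) H = rescaleBeta m * meanGap D (gap P a) H := by
  simp only [meanGap, rescaledGap_eq, Finset.mul_sum]
  exact Finset.sum_congr rfl fun i _ => by ring

lemma expect_baseRegret_eq_mul (a : Fin K) (T : ℕ) :
    expect (metaDuelingLaw hm D (fun _ => P) T) (baseRegret (fun _ => P) a) =
      rescaleBeta m *
        expect (metaDuelingLaw hm D (fun _ => P) T) (condorcetRegret (fun _ => P) a) := by
  rw [expect_baseRegret, expect_condorcetRegret]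
  simp only [meanGap_rescaledGap, ← Finset.mul_sum, expect_const_mul]

lemma expect_baseRegret_eq_suboptimalMass (a : Fin K) (T : ℕ) :
    expect (metaDuelingLaw hm D (fun _ => P) T) (baseRegret (fun _ => P) a) =
      1 / 2 * expect (metaDuelingLaw hm D (fun _ => P) T) (suboptimalMass D P a) := by
  rw [expect_baseRegret, ← expect_const_mul]
  congr 1
  funext h
  rw [suboptimalMass, Finset.mul_sum]
  refine Finset.sum_congr rfl fun t _ => ?_
  rw [meanGap, ← Finset.add_sum_erase _ _ (Finset.mem_univ a), rescaledGap_self, mul_zero, zero_add]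

end Trajectory

/-! ### Regret of MetaDueling with Versatile-DB -/

lemma toReal_tsallisLaw {K : ℕ} [NeZero K] (t : ℕ) (L : Fin K → ℝ) (k : Fin K) :
    (tsallisLaw t L k).toReal = tsallisWeights t L k := by
  rw [tsallisLaw, PMF.ofFintype_apply, ENNReal.toReal_ofReal ((tsallisWeights_mem t L).1 k)]

/-- Sum of the potentials of the two players. -/
def jointPotential {K : ℕ} [NeZero K] (a : Fin K) (H : List (Duel K)) : ℝ :=
  playerPotential a H.length (versatileLosses H).1 +
    playerPotential a H.length (versatileLosses H).2

lemma jointPotential_win {K : ℕ} [NeZero K] (a x y : Fin K) (H : List (Duel K)) :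
    jointPotential a (⟨x, y, true⟩ :: H) =
      playerPotential a (H.length + 1) (versatileLosses H).1 +
      playerPotential a (H.length + 1) (fun i => (versatileLosses H).2 i +
        weightedLoss (H.length + 1) (versatileLosses H).2 y i) := by
  have h : ∀ k, (versatileLosses H).2 k + (if k = y then
      1 / tsallisWeights (H.length + 1) (versatileLosses H).2 k else 0) =
      (versatileLosses H).2 k + weightedLoss (H.length + 1) (versatileLosses H).2 y k := fun k => by
    unfold weightedLoss
    split_ifs with hk
    · rw [hk]
    · rfl
  simp only [jointPotential, versatileLosses, List.length_cons, if_true, zero_div, ite_self,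
    add_zero, h]

lemma jointPotential_loss {K : ℕ} [NeZero K] (a x y : Fin K) (H : List (Duel K)) :
    jointPotential a (⟨x, y, false⟩ :: H) =
      playerPotential a (H.length + 1) (fun i => (versatileLosses H).1 i +
        weightedLoss (H.length + 1) (versatileLosses H).1 x i) +
      playerPotential a (H.length + 1) (versatileLosses H).2 := by
  have h : ∀ k, (versatileLosses H).1 k + (if k = x then
      1 / tsallisWeights (H.length + 1) (versatileLosses H).1 k else 0) =
      (versatileLosses H).1 k + weightedLoss (H.length + 1) (versatileLosses H).1 x k := fun k => by
    unfold weightedLoss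
    split_ifs with hk
    · rw [hk]
    · rfl
  simp only [jointPotential, versatileLosses, List.length_cons, Bool.false_eq_true, if_false,
    zero_div, ite_self, add_zero, h]

/-- Separation of the two players in the expectation over a duel. -/
lemma sum_sum_duel {ι : Type*} [Fintype ι] {p q : ι → ℝ} (hp : ∑ i, p i = 1)
    (hq : ∑ i, q i = 1) (M : ι → ι → ℝ) (A B : ι → ℝ) (A₀ B₀ : ℝ) :
    ∑ x, p x * ∑ y, q y * (M x y * (A₀ + B y) + (1 - M x y) * (A x + B₀)) =
      ∑ x, p x * ((∑ y, q y * (1 - M x y)) * A x + (1 - ∑ y, q y * (1 - M x y)) * A₀) +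
      ∑ y, q y * ((∑ x, p x * M x y) * B y + (1 - ∑ x, p x * M x y) * B₀) := by
  have h1 : ∀ x, (1 - ∑ y, q y * (1 - M x y)) = ∑ y, q y * M x y := fun x => by
    simp only [mul_sub, mul_one, Finset.sum_sub_distrib, hq]; ring
  have h2 : ∀ y, (1 - ∑ x, p x * M x y) = ∑ x, p x * (1 - M x y) := fun y => by
    simp only [mul_sub, mul_one, Finset.sum_sub_distrib, hp]
  simp only [h1, h2, Finset.mul_sum, Finset.sum_mul, mul_add, Finset.sum_add_distrib]
  rw [Finset.sum_comm (f := fun y x => q y * (p x * M x y * B y)),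
    Finset.sum_comm (f := fun y x => q y * (p x * (1 - M x y) * B₀))]
  simp only [← Finset.sum_add_distrib]
  exact Finset.sum_congr rfl fun x _ => Finset.sum_congr rfl fun y _ => by ring

/-- The regrets of the two players add up to the weighted gaps. -/
lemma sum_regret_eq {K : ℕ} (m : ℕ) (P : PrefMatrix K) (a : Fin K) {p q : Fin K → ℝ}
    (hp : ∑ i, p i = 1) (hq : ∑ i, q i = 1) :
    (∑ x, p x * ∑ y, q y * (1 - rescaledPref m P x y) - ∑ y, q y * (1 - rescaledPref m P a y)) +
      (∑ y, q y * ∑ x, p x * rescaledPref m P x y - ∑ x, p x * rescaledPref m P x a) =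
      ∑ i, (p i + q i) * rescaledGap m P a i := by
  -- Exactly one player loses each duel.
  have h1 : ∑ x, p x * ∑ y, q y * (1 - rescaledPref m P x y) +
      ∑ y, q y * ∑ x, p x * rescaledPref m P x y = 1 := by
    simp only [Finset.mul_sum]
    rw [Finset.sum_comm (f := fun y x => q y * (p x * rescaledPref m P x y)),
      ← Finset.sum_add_distrib]
    refine Eq.trans (Finset.sum_congr rfl fun x _ => ?_) hp
    rw [← Finset.sum_add_distrib]
    conv_rhs => rw [← mul_one (p x), ← hq, Finset.mul_sum]
    exact Finset.sum_congr rfl fun y _ => by ring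
  have h2 : ∑ y, q y * (1 - rescaledPref m P a y) = 1 / 2 - ∑ i, q i * rescaledGap m P a i := by
    have e : ∀ y, q y * (1 - rescaledPref m P a y) =
        q y * (1 / 2) - q y * rescaledGap m P a y := fun y => by rw [rescaledGap]; ring
    simp only [e, Finset.sum_sub_distrib, ← Finset.sum_mul, hq, one_mul]
  have h3 : ∑ x, p x * rescaledPref m P x a = 1 / 2 - ∑ i, p i * rescaledGap m P a i := by
    have e : ∀ x, p x * rescaledPref m P x a =
        p x * (1 / 2) - p x * rescaledGap m P a x := fun x => by
      rw [rescaledGap]; linear_combination p x * rescaledPref_add m P x a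
    simp only [e, Finset.sum_sub_distrib, ← Finset.sum_mul, hp, one_mul]
  simp only [add_mul, Finset.sum_add_distrib]
  linarith

lemma sum_mul_mem_Icc {ι : Type*} [Fintype ι] {p f : ι → ℝ} (hp : p ∈ stdSimplex ℝ ι)
    (h0 : ∀ i, 0 ≤ f i) (h1 : ∀ i, f i ≤ 1) : 0 ≤ ∑ i, p i * f i ∧ ∑ i, p i * f i ≤ 1 := by
  refine ⟨Finset.sum_nonneg fun i _ => mul_nonneg (hp.1 i) (h0 i), ?_⟩
  rw [← hp.2]
  exact Finset.sum_le_sum fun i _ => mul_le_of_le_one_right (hp.1 i) (h1 i)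

lemma expect_jointPotential {K m : ℕ} [NeZero K] (hm : 2 ≤ m) (P : PrefMatrix K) (a : Fin K)
    (H : List (Duel K)) :
    expect (roundLaw hm (versatileDB K) P H)
        (fun r : Round K m => jointPotential a (r.duel :: H)) =
      ∑ x, tsallisWeights (H.length + 1) (versatileLosses H).1 x *
        ∑ y, tsallisWeights (H.length + 1) (versatileLosses H).2 y *
          (rescaledPref m P x y * jointPotential a (⟨x, y, true⟩ :: H) +
            (1 - rescaledPref m P x y) * jointPotential a (⟨x, y, false⟩ :: H)) := by
  rw [expect_roundLaw]
  simp only [versatileDB, toReal_tsallisLaw]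
  refine Finset.sum_congr rfl fun x _ => ?_
  congr 1
  refine Finset.sum_congr rfl fun y _ => ?_
  congr 1
  exact expect_duel hm P x y fun o => jointPotential a (⟨x, y, o⟩ :: H)

/-- Drift of the joint potential in one round. -/
lemma sum_mul_gap_le {K m : ℕ} [NeZero K] (hm : 2 ≤ m) (P : PrefMatrix K) (a : Fin K)
    (H : List (Duel K)) :
    ∑ i, (tsallisWeights (H.length + 1) (versatileLosses H).1 i +
        tsallisWeights (H.length + 1) (versatileLosses H).2 i) * rescaledGap m P a i ≤
      expect (roundLaw hm (versatileDB K) P H)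
        (fun r : Round K m => jointPotential a (r.duel :: H)) - jointPotential a H
      + (playerError a (H.length + 1) (versatileLosses H).1
        + playerError a (H.length + 1) (versatileLosses H).2) := by
  have hp := tsallisWeights_mem (H.length + 1) (versatileLosses H).1
  have hq := tsallisWeights_mem (H.length + 1) (versatileLosses H).2
  have hM := rescaledPref_mem hm P
  -- Averaging over the opponent's independent arm turns the duel into a Bernoulli loss for each
  -- arm, as `player_regret_le` requires.
  have hc1 : ∀ x, _ := fun x => sum_mul_mem_Icc (f := fun y => 1 - rescaledPref m P x y) hq
    (fun y => by linarith [(hM x y).2]) (fun y => by linarith [(hM x y).1])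
  have hc2 : ∀ y, _ := fun y => sum_mul_mem_Icc (f := fun x => rescaledPref m P x y) hp
    (fun x => (hM x y).1) (fun x => (hM x y).2)
  have h1 := player_regret_le H.length (versatileLosses H).1 a _
    (fun x => (hc1 x).1) (fun x => (hc1 x).2)
  have h2 := player_regret_le H.length (versatileLosses H).2 a _
    (fun x => (hc2 x).1) (fun x => (hc2 x).2)
  rw [expect_jointPotential, ← sum_regret_eq m P a hp.2 hq.2]
  simp only [jointPotential_win, jointPotential_loss]
  rw [sum_sum_duel hp.2 hq.2, jointPotential]
  linarith

/-- AM-GM, the difference being a perfect square. The weight `1/2` lets the errors of both players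
consume only half of the weighted gaps. -/
lemma sqrt_le_self_bound {t : ℕ} (ht : 0 < t) {p g : ℝ} (hp : 0 ≤ p) (hg : 0 < g) :
    4 / √(t : ℝ) * √p ≤ 1 / 2 * (p * g) + 8 / (t * g) := by
  have ht' : (0 : ℝ) < t := by exact_mod_cast ht
  have hs := Real.sqrt_pos.2 ht'
  have h1 := Real.sq_sqrt ht'.le
  have h2 := Real.sq_sqrt hp
  have h : 1 / 2 * (p * g) + 8 / (t * g) - 4 / √(t : ℝ) * √p =
      (√p * √(t : ℝ) * g - 4) ^ 2 / (2 * t * g) := by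
    generalize √(t : ℝ) = s at hs h1
    generalize √p = r at h2
    rw [← h1, ← h2]
    field_simp
    ring
  have h3 : 0 ≤ (√p * √(t : ℝ) * g - 4) ^ 2 / (2 * t * g) := by positivity
  linarith

/-- The self-bounding step: `sum_mul_gap_le` bounds twice `meanGap`, and one copy is absorbed by the
error terms. -/
lemma meanGap_drift {K m : ℕ} [NeZero K] (hm : 2 ≤ m) (P : PrefMatrix K) (a : Fin K)
    (hgap : ∀ i, i ≠ a → 0 < gap P a i) (H : List (Duel K)) :
    meanGap (versatileDB K) (rescaledGap m P a) H ≤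
      expect (roundLaw hm (versatileDB K) P H)
        (fun r : Round K m => jointPotential a (r.duel :: H)) - jointPotential a H
      + (∑ i ∈ Finset.univ.erase a, 16 / rescaledGap m P a i + 4) / ((H.length + 1 : ℕ) : ℝ) := by
  have h := sum_mul_gap_le hm P a H
  set p := tsallisWeights (H.length + 1) (versatileLosses H).1 with hp
  set q := tsallisWeights (H.length + 1) (versatileLosses H).2 with hq
  have hp0 : ∀ i, 0 ≤ p i := (tsallisWeights_mem _ _).1
  have hq0 : ∀ i, 0 ≤ q i := (tsallisWeights_mem _ _).1
  have hE : meanGap (versatileDB K) (rescaledGap m P a) H =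
      1 / 2 * ∑ i, (p i + q i) * rescaledGap m P a i := by
    simp only [meanGap, versatileDB, toReal_tsallisLaw, hp, hq]
  have hb : ∑ i ∈ Finset.univ.erase a,
      (4 / √((H.length + 1 : ℕ) : ℝ) * √(p i) + 4 / √((H.length + 1 : ℕ) : ℝ) * √(q i)) ≤
      ∑ i ∈ Finset.univ.erase a, (1 / 2 * ((p i + q i) * rescaledGap m P a i) +
        16 / rescaledGap m P a i / ((H.length + 1 : ℕ) : ℝ)) := by
    refine Finset.sum_le_sum fun i hi => ?_
    have hg : 0 < rescaledGap m P a i := by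
      rw [rescaledGap_eq]
      exact mul_pos (by linarith [(rescaleBeta_mem hm).1]) (hgap i (Finset.ne_of_mem_erase hi))
    have h1 := sqrt_le_self_bound H.length.succ_pos (hp0 i) hg
    have h2 := sqrt_le_self_bound H.length.succ_pos (hq0 i) hg
    have e : 16 / rescaledGap m P a i / ((H.length + 1 : ℕ) : ℝ) =
        8 / (((H.length + 1 : ℕ) : ℝ) * rescaledGap m P a i) +
        8 / (((H.length + 1 : ℕ) : ℝ) * rescaledGap m P a i) := by
      field_simp; norm_num
    simp only [Nat.succ_eq_add_one] at h1 h2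
    linarith
  rw [Finset.sum_add_distrib, Finset.sum_add_distrib, ← Finset.mul_sum, ← Finset.mul_sum,
    ← Finset.mul_sum, ← Finset.sum_div] at hb
  rw [← Finset.add_sum_erase _ _ (Finset.mem_univ a), rescaledGap_self, mul_zero, zero_add] at hE h
  simp only [playerError, ← hp, ← hq] at h
  have e : (∑ i ∈ Finset.univ.erase a, 16 / rescaledGap m P a i + 4) / ((H.length + 1 : ℕ) : ℝ) =
      (∑ i ∈ Finset.univ.erase a, 16 / rescaledGap m P a i) / ((H.length + 1 : ℕ) : ℝ) +
      2 / ((H.length + 1 : ℕ) : ℝ) + 2 / ((H.length + 1 : ℕ) : ℝ) := by ring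
  linarith

lemma sum_range_div_succ_le {c : ℝ} (hc : 0 ≤ c) (T : ℕ) :
    ∑ t ∈ Finset.range T, c / ((t + 1 : ℕ) : ℝ) ≤ c * (1 + Real.log T) := by
  have h := harmonic_le_one_add_log T
  rw [harmonic] at h
  push_cast at h
  simp only [div_eq_mul_inv, ← Finset.mul_sum]
  push_cast
  gcongr

/-- Logarithmic Condorcet regret of MetaDueling with Versatile-DB. -/
lemma expect_condorcetRegret_le {K m : ℕ} [NeZero K] (hm : 2 ≤ m) (P : PrefMatrix K) (a : Fin K)
    (hgap : ∀ i, i ≠ a → 0 < gap P a i) (T : ℕ) :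
    expect (metaDuelingLaw hm (versatileDB K) (fun _ => P) T) (condorcetRegret (fun _ => P) a) ≤
      (∑ i ∈ Finset.univ.erase a, 64 / gap P a i + 8) * (1 + Real.log T) := by
  obtain ⟨hβ, -⟩ := rescaleBeta_mem hm
  have hβ0 : 0 < rescaleBeta m := by linarith
  have h := expect_sum_le_of_drift hm (versatileDB K) P _ _
    (fun n => (∑ i ∈ Finset.univ.erase a, 16 / rescaledGap m P a i + 4) / ((n + 1 : ℕ) : ℝ))
    (meanGap_drift hm P a hgap) T
  rw [← expect_baseRegret, expect_baseRegret_eq_mul] at h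
  have hW0 : jointPotential a [] = 0 := by
    simp [jointPotential, versatileLosses, playerPotential_zero]
  have hW := expect_mono (metaDuelingLaw hm (versatileDB K) (fun _ => P) T)
    (fun h => add_nonpos (playerPotential_nonpos a (baseHistory T h).length
        (versatileLosses (baseHistory T h)).1)
      (playerPotential_nonpos a (baseHistory T h).length (versatileLosses (baseHistory T h)).2))
  rw [expect_const] at hW
  -- One factor `1 / β_m ≤ 2` comes from the rescaled gap and another from converting base regret to
  -- Condorcet regret: `16` becomes `64` and `4` becomes `8`.
  have hsum : ∑ i ∈ Finset.univ.erase a, 16 / rescaledGap m P a i + 4 ≤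
      rescaleBeta m * (∑ i ∈ Finset.univ.erase a, 64 / gap P a i + 8) := by
    rw [mul_add, Finset.mul_sum]
    refine add_le_add (Finset.sum_le_sum fun i hi => ?_) (by linarith)
    have hg := hgap i (Finset.ne_of_mem_erase hi)
    rw [rescaledGap_eq, ← mul_div_assoc, div_le_div_iff₀ (by positivity) hg]
    nlinarith [mul_nonneg hg.le (by nlinarith : 0 ≤ rescaleBeta m ^ 2 - 1 / 4)]
  have hnn : 0 ≤ ∑ i ∈ Finset.univ.erase a, 16 / rescaledGap m P a i + 4 := by
    refine add_nonneg (Finset.sum_nonneg fun i hi => ?_) (by norm_num)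
    have hg := hgap i (Finset.ne_of_mem_erase hi)
    rw [rescaledGap_eq]
    positivity
  have hH := sum_range_div_succ_le hnn T
  have hlog : 0 ≤ 1 + Real.log T := by linarith [Real.log_natCast_nonneg T]
  have hfin := mul_le_mul_of_nonneg_right hsum hlog
  simp only [jointPotential] at h hW0
  refine le_of_mul_le_mul_left ?_ hβ0
  linarith

/-- The logarithmic regret bound is of order `∑ log T / Δ`. -/
lemma regretBound_le {K T : ℕ} (hK : 2 ≤ K) (hT : 2 ≤ T) (P : PrefMatrix K) (a : Fin K)
    (hgap : ∀ i, i ≠ a → 0 < gap P a i) :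
    (∑ i ∈ Finset.univ.erase a, (64 * Real.log T + 192) / gap P a i)
        + 8 * Real.log T + 24 + 16 * √(K : ℝ) ≤
      1000 * ∑ i ∈ Finset.univ.erase a, Real.log T / gap P a i := by
  have hl : 1 / 2 ≤ Real.log T := by
    have h1 := Real.log_two_gt_d9
    have h2 := Real.log_le_log (by norm_num) (by exact_mod_cast hT : (2 : ℝ) ≤ T)
    linarith
  have hK' : (2 : ℝ) ≤ K := by exact_mod_cast hK
  have hsqrt : √(K : ℝ) ≤ K := by
    rw [Real.sqrt_le_left (by linarith)]; nlinarith
  -- Gaps are at most `1/2`, so the sum dominates `K log T`, and with it the constants and `√K`.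
  have hcount : ((K : ℝ) - 1) * (2 * Real.log T) ≤
      ∑ i ∈ Finset.univ.erase a, Real.log T / gap P a i := by
    have h : ∀ i ∈ Finset.univ.erase a, 2 * Real.log T ≤ Real.log T / gap P a i := fun i hi => by
      have hg := hgap i (Finset.ne_of_mem_erase hi)
      have hg1 : gap P a i ≤ 1 / 2 := by have := P.le_one a i; rw [gap]; linarith
      rw [le_div_iff₀ hg]
      nlinarith
    have h2 := Finset.card_nsmul_le_sum _ _ _ h
    rw [Finset.card_erase_of_mem (Finset.mem_univ a), Finset.card_univ, Fintype.card_fin,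
      nsmul_eq_mul, Nat.cast_sub (by omega), Nat.cast_one] at h2
    exact h2
  -- Since `log T ≥ 1/2`, `192 ≤ 384 log T`, and `448 = 64 + 384`.
  have hmain : ∑ i ∈ Finset.univ.erase a, (64 * Real.log T + 192) / gap P a i ≤
      448 * ∑ i ∈ Finset.univ.erase a, Real.log T / gap P a i := by
    rw [Finset.mul_sum]
    refine Finset.sum_le_sum fun i hi => ?_
    have hg := hgap i (Finset.ne_of_mem_erase hi)
    rw [← mul_div_assoc]
    gcongr
    linarith
  have h3 : (K : ℝ) / 2 ≤ (K : ℝ) - 1 := by linarith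
  have h4 : (K : ℝ) * Real.log T ≤ ((K : ℝ) - 1) * (2 * Real.log T) := by nlinarith
  have h5 : 2 * Real.log T ≤ K * Real.log T := by nlinarith
  have h6 : K * (1 / 2) ≤ K * Real.log T := by nlinarith
  linarith

end MultiDueling

end

open MultiDueling
theorem corollary2 :
    ∃ C : ℝ, 0 < C ∧
      ∀ (K m T : ℕ) [NeZero K] (hm : 2 ≤ m) (_hmK : m ≤ K) (_hT : 1 ≤ T)
        (P : PrefMatrix K) (a : Fin K) (_hwin : IsCondorcetWinner P a)
        (_hgap : ∀ i, i ≠ a → 0 < gap P a i),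
        -- the self-bounding condition holds, with equality
        (expect (metaDuelingLaw hm (versatileDB K) (fun _ => P) T)
            (baseRegret (fun _ => P) a) =
          1 / 2 * expect (metaDuelingLaw hm (versatileDB K) (fun _ => P) T)
            (suboptimalMass (versatileDB K) P a)) ∧
        -- the regret bound
        (expect (metaDuelingLaw hm (versatileDB K) (fun _ => P) T)
            (condorcetRegret (fun _ => P) a) ≤
          (∑ i ∈ Finset.univ.erase a, (64 * Real.log T + 192) / gap P a i)
            + 8 * Real.log T + 24 + 16 * √(K : ℝ)) ∧
        -- its order of magnitude, with a universal constant
        (2 ≤ T →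
          (∑ i ∈ Finset.univ.erase a, (64 * Real.log T + 192) / gap P a i)
            + 8 * Real.log T + 24 + 16 * √(K : ℝ) ≤
          C * ∑ i ∈ Finset.univ.erase a, Real.log T / gap P a i) := by
  refine ⟨1000, by norm_num, fun K m T _ hm hmK _ P a _ hgap => ⟨?_, ?_, fun hT => ?_⟩⟩
  · exact expect_baseRegret_eq_suboptimalMass hm (versatileDB K) P a T
  · have hlog := Real.log_natCast_nonneg T
    -- This is stronger than required: `64 ≤ 192`, `8 ≤ 24`, and the `√K` term is pure slack.
    have h := expect_condorcetRegret_le hm P a hgap T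
    have h1 : (∑ i ∈ Finset.univ.erase a, 64 / gap P a i) * (1 + Real.log T) ≤
        ∑ i ∈ Finset.univ.erase a, (64 * Real.log T + 192) / gap P a i := by
      rw [Finset.sum_mul]
      refine Finset.sum_le_sum fun i hi => ?_
      have hg := hgap i (Finset.ne_of_mem_erase hi)
      rw [div_mul_eq_mul_div]
      gcongr
      linarith
    have h2 := Real.sqrt_nonneg (K : ℝ)
    linarith
  · exact regretBound_le (hm.trans hmK) hT P a hgap
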